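/- **Setting.** Let $P$ be a finite set of points in the plane, no four on a circle, and let $\delta\ge 0$. For disjoint $S,T\subseteq P$, a *solution* for $(S,T)$ is a pair of closed disks $(D_+,D_-)$ such that $D_+\supseteq S$, $D_-\supseteq T$, and the centers are at distance at most $\delta$. Its *cost* is the larger of the two radii. A *best optimal solution* (BOS) is a solution of minimum cost whose smaller radius is minimum among all solutions of minimum cost. Given a BOS of $(S,T)$, a point $x\in S$ is a *dominating point* of $D_+$ if $(D_+,D_-)$ is not a BOS of $(S\setminus\{x\},T)$, and a point $x\in T$ is a *dominating point* of $D_-$ if $(D_+,D_-)$ is not a BOS of $(S,T\setminus\{x\})$. Let $m$ be a point of the convex hull of $P$, and let $\ell$ be a directed line through $m$ that contains no point of $P$. Let $p_1,\dots,p_{n'}$ (the $p$-type points) be the points of $P$ to the left of $\ell$ and $q_1,\dots,q_{n''}$ (the $q$-type points) those to its right, each sequence sorted by strictly increasing magnitude of the angle at $m$ from the positive direction of $\ell$ (no ties). For $0\le i\le n'$ and $0\le j\le n''$ put $P_+^{i,j}=\{p_1,\dots,p_i,q_1,\dots,q_j\}$ and $P_-^{i,j}=P\setminus P_+^{i,j}$.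 To *evaluate* $[i,j]$ is to compute a BOS $(D_+^{i,j},D_-^{i,j})$ of $(P_+^{i,j},P_-^{i,j})$ and its dominating points. Let $M^+$ be the $(n'+1)\times(n''+1)$ matrix with $M^+[i,j]=\mathrm{radius}(D_+^{i,j})$. The element $M^+[i,j]$ is *valid* if $M^+[i,j]\ge \mathrm{radius}(D_-^{i,j})$, and *critical* if $D_+^{i,j}$ is not the minimum enclosing disk of $P_+^{i,j}$. Assume general position: if $D_\pm^{i,j}$ is not the minimum enclosing disk of $P_\pm^{i,j}$, then at most two points of $P_\pm^{i,j}$ lie on its boundary. **Marking.** Let $\mathcal T$ and $\mathcal B$ be the sets of elements evaluated in the initial searches of $M^+$ from the top-right and from the bottom-left. (The statement holds for arbitrary sets $\mathcal T,\mathcal B$ of indices, so the order in which the searches visit the elements does not matter.) * Evaluating $[i_0,j]\in\mathcal T$ *marks* $[i,j]$ in the top-right search if $M^+[i_0,j]$ is valid and critical, not all dominating points of $D_+^{i_0,j}$ are $p$-type, not all dominating points of $D_-^{i_0,j}$ are $q$-type, and $i\ge k$ for some $p$-type dominating point $p_k$ of $D_-^{i_0,j}$. * Symmetrically, evaluating $[i,j_0]\in\mathcal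 B$ *marks* $[i,j]$ in the bottom-left search if $M^+[i,j_0]$ is valid and critical, not all dominating points of $D_+^{i,j_0}$ are $q$-type, not all dominating points of $D_-^{i,j_0}$ are $p$-type, and $j\ge k$ for some $q$-type dominating point $q_k$ of $D_-^{i,j_0}$. The element $[i,j]$ is *doubly-marked* if it is marked by some element of $\mathcal T$ and by some element of $\mathcal B$. **Discarding.** After $[i,j]$ has been evaluated, the *known values* are the values $M^+[e]$ of the valid elements $e\in\mathcal T\cup\mathcal B$, together with the cost $\max\{\mathrm{radius}(D_+^{i,j}),\mathrm{radius}(D_-^{i,j})\}$. A set of elements *can be discarded* if each of its valid elements $M^+[i',j']$ is at least some known value; in other words, the set contains no valid element smaller than all the known values. **Theorem.** Let $[i,j]$ be doubly-marked. After $[i,j]$ has been evaluated, at least one of the following can be discarded: 1. the elements above $[i,j]$, namely $M^+[i',j]$ with $i'\le i$; 2. the elements below $[i,j]$, namely $M^+[i',j]$ with $i'\ge i$; 3. the elements in front of $[i,j]$, namely $M^+[i,j']$ with $j'\ge j$. -/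

import Mathlib

open Set

namespace PCTC

/-- A closed disk of the plane `ℂ`, given by its centre and its nonnegative radius. -/
structure Disk where
  center : ℂ
  radius : ℝ
  radius_nonneg : 0 ≤ radius

/-- The disk `D` covers the point set `S`. -/
def Disk.Covers (D : Disk) (S : Set ℂ) : Prop :=
  ∀ z ∈ S, dist z D.center ≤ D.radius

/-- `D` is a minimum enclosing disk of `S`. -/
def Disk.IsMED (D : Disk) (S : Set ℂ) : Prop :=
  D.Covers S ∧ ∀ E : Disk, E.Covers S → D.radius ≤ E.radius

/-- The points of `S` that lie on the boundary circle of `D`. -/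
def Disk.boundaryPoints (D : Disk) (S : Set ℂ) : Set ℂ :=
  {z ∈ S | dist z D.center = D.radius}

/-- A pair of disks: `pos` is meant for the positive part of a partition, `neg` for the
negative part. -/
structure DiskPair where
  pos : Disk
  neg : Disk

/-- The radius of the determining (larger) disk. -/
def DiskPair.cost (D : DiskPair) : ℝ := max D.pos.radius D.neg.radius

/-- The radius of the non-determining (smaller) disk. -/
def DiskPair.smallRadius (D : DiskPair) : ℝ := min D.pos.radius D.neg.radius

/-- `D` is a solution of the restricted problem for the partition `(S, T)`: the first disk covers
`S`, the second covers `T`, and the centres are at distance at most `δ`. -/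
def DiskPair.IsSolution (D : DiskPair) (δ : ℝ) (S T : Set ℂ) : Prop :=
  D.pos.Covers S ∧ D.neg.Covers T ∧ dist D.pos.center D.neg.center ≤ δ

/-- `D` is a best optimal solution (BOS) of the restricted problem for `(S, T)`: its cost is
minimum among all solutions, and the radius of its smaller disk is minimum among all optimal
solutions. -/
def DiskPair.IsBOS (D : DiskPair) (δ : ℝ) (S T : Set ℂ) : Prop :=
  D.IsSolution δ S T ∧
    ∀ E : DiskPair, E.IsSolution δ S T →
      D.cost ≤ E.cost ∧ (E.cost = D.cost → D.smallRadius ≤ E.smallRadius)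

/-- `x` is a dominating point of the positive disk of the BOS `D` of `(S, T)`. -/
def DiskPair.PosDominating (D : DiskPair) (δ : ℝ) (S T : Set ℂ) (x : ℂ) : Prop :=
  x ∈ S ∧ ¬ D.IsBOS δ (S \ {x}) T

/-- `x` is a dominating point of the negative disk of the BOS `D` of `(S, T)`. -/
def DiskPair.NegDominating (D : DiskPair) (δ : ℝ) (S T : Set ℂ) (x : ℂ) : Prop :=
  x ∈ T ∧ ¬ D.IsBOS δ S (T \ {x})

/-- The angle in `(-π, π]` at which `z` is seen from `m`, measured from the direction `u`. -/
noncomputable def angleFrom (m u z : ℂ) : ℝ := Complex.arg ((z - m) / u)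

/-- The angular orders around `m` of the points of `P` with respect to the `m`-line, which is the
line through `m` with positive direction `u`. No point of `P` lies on the `m`-line; `p` lists the
points on its left side and `q` those on its right side, each sequence by strictly increasing
magnitude of the angle from the positive direction. The lists are indexed from `0`, so `p k` is
the `p`-type point usually numbered `k + 1`. -/
structure AngularOrder (P : Finset ℂ) (m u : ℂ) (a b : ℕ) where
  p : Fin a → ℂ
  q : Fin b → ℂ
  off_line : ∀ z ∈ P, ((z - m) / u).im ≠ 0
  range_p : range p = {z | z ∈ P ∧ 0 < angleFrom m u z}
  range_q : range q = {z | z ∈ P ∧ angleFrom m u z < 0}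
  strictMono_p : StrictMono fun k => |angleFrom m u (p k)|
  strictMono_q : StrictMono fun k => |angleFrom m u (q k)|

namespace AngularOrder

variable {P : Finset ℂ} {m u : ℂ} {a b : ℕ}

/-- The positive side of the `(i, j)`-partition: the first `i` points of `p` and the first `j`
points of `q`. -/
def posSide (s : AngularOrder P m u a b) (i : Fin (a + 1)) (j : Fin (b + 1)) : Set ℂ :=
  {z | (∃ k : Fin a, (k : ℕ) < i ∧ z = s.p k) ∨ (∃ k : Fin b, (k : ℕ) < j ∧ z = s.q k)}

/-- The negative side of the `(i, j)`-partition: all the other points. -/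
def negSide (s : AngularOrder P m u a b) (i : Fin (a + 1)) (j : Fin (b + 1)) : Set ℂ :=
  {z | (∃ k : Fin a, (i : ℕ) ≤ k ∧ z = s.p k) ∨ (∃ k : Fin b, (j : ℕ) ≤ k ∧ z = s.q k)}

/-- A choice of a BOS `(D₊^{i,j}, D₋^{i,j})` for every `(i, j)`-partition: the outputs of the
evaluations of the matrix elements. -/
structure Evaluation (s : AngularOrder P m u a b) (δ : ℝ) where
  D : Fin (a + 1) → Fin (b + 1) → DiskPair
  isBOS : ∀ i j, (D i j).IsBOS δ (s.posSide i j) (s.negSide i j)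

namespace Evaluation

variable {s : AngularOrder P m u a b} {δ : ℝ}

/-- The matrix `M⁺` of the radii of the positive disks. -/
def M (V : s.Evaluation δ) : Matrix (Fin (a + 1)) (Fin (b + 1)) ℝ :=
  Matrix.of fun i j => (V.D i j).pos.radius

/-- `M⁺[i, j]` is valid. -/
def Valid (V : s.Evaluation δ) (i : Fin (a + 1)) (j : Fin (b + 1)) : Prop :=
  (V.D i j).neg.radius ≤ V.M i j

/-- `M⁺[i, j]` is critical: the positive disk is not the minimum enclosing disk of its side. -/
def Critical (V : s.Evaluation δ) (i : Fin (a + 1)) (j : Fin (b + 1)) : Prop :=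
  ¬ (V.D i j).pos.IsMED (s.posSide i j)

/-- `x` is a dominating point of `D₊^{i,j}`. -/
def DomPos (V : s.Evaluation δ) (i : Fin (a + 1)) (j : Fin (b + 1)) (x : ℂ) : Prop :=
  (V.D i j).PosDominating δ (s.posSide i j) (s.negSide i j) x

/-- `x` is a dominating point of `D₋^{i,j}`. -/
def DomNeg (V : s.Evaluation δ) (i : Fin (a + 1)) (j : Fin (b + 1)) (x : ℂ) : Prop :=
  (V.D i j).NegDominating δ (s.posSide i j) (s.negSide i j) x

/-- General position of the partitions: a disk that is not the minimum enclosing disk of its side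
has at most two points of that side on its boundary. -/
def Generic (V : s.Evaluation δ) : Prop :=
  ∀ i j,
    (¬ (V.D i j).pos.IsMED (s.posSide i j) →
      ((V.D i j).pos.boundaryPoints (s.posSide i j)).encard ≤ 2) ∧
    (¬ (V.D i j).neg.IsMED (s.negSide i j) →
      ((V.D i j).neg.boundaryPoints (s.negSide i j)).encard ≤ 2)

/-- In the search from the top-right, the evaluation of `[i₀, j]` marks `[i, j]`: the element
`[i₀, j]` is valid and critical; the evaluation neither discards the rest of its row (which happens
when all dominating points of the positive disk are `p`-type) nor the rest of its column (which
happens when all dominating points of the negative disk are `q`-type); and `[i, j]` is not among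
the discarded elements of the column, whose row index is smaller than that of the `p`-type
dominating points of the negative disk. -/
def MarksInColumn (V : s.Evaluation δ) (i₀ : Fin (a + 1)) (j : Fin (b + 1))
    (i : Fin (a + 1)) : Prop :=
  V.Valid i₀ j ∧ V.Critical i₀ j ∧
    (¬ ∀ x, V.DomPos i₀ j x → x ∈ range s.p) ∧
    (¬ ∀ x, V.DomNeg i₀ j x → x ∈ range s.q) ∧
    ∃ k : Fin a, V.DomNeg i₀ j (s.p k) ∧ (k : ℕ) + 1 ≤ i

/-- The mirror image of `MarksInColumn`: in the search from the bottom-left, the evaluation of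
`[i, j₀]` marks `[i, j]`. -/
def MarksInRow (V : s.Evaluation δ) (i : Fin (a + 1)) (j₀ : Fin (b + 1))
    (j : Fin (b + 1)) : Prop :=
  V.Valid i j₀ ∧ V.Critical i j₀ ∧
    (¬ ∀ x, V.DomPos i j₀ x → x ∈ range s.q) ∧
    (¬ ∀ x, V.DomNeg i j₀ x → x ∈ range s.p) ∧
    ∃ k : Fin b, V.DomNeg i j₀ (s.q k) ∧ (k : ℕ) + 1 ≤ j

/-- `[i, j]` is doubly-marked if the searches from the top-right and from the bottom-left evaluate
the elements in `T` and in `B` respectively: each of them marks `[i, j]`. -/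
def DoublyMarked (V : s.Evaluation δ) (T B : Set (Fin (a + 1) × Fin (b + 1)))
    (i : Fin (a + 1)) (j : Fin (b + 1)) : Prop :=
  (∃ i₀, (i₀, j) ∈ T ∧ V.MarksInColumn i₀ j i) ∧
    (∃ j₀, (i, j₀) ∈ B ∧ V.MarksInRow i j₀ j)

/-- The values known once `[i, j]` is evaluated after the elements of `E`: the candidate values
`M⁺[e]` of the valid `e ∈ E`, and the cost of the `(i, j)`-partition, that is `M⁺[i, j]` if
`[i, j]` is valid and the radius of `D₋^{i,j}` otherwise. -/
def knownValues (V : s.Evaluation δ) (E : Set (Fin (a + 1) × Fin (b + 1)))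
    (i : Fin (a + 1)) (j : Fin (b + 1)) : Set ℝ :=
  {r | (∃ e ∈ E, V.Valid e.1 e.2 ∧ r = V.M e.1 e.2) ∨ r = (V.D i j).cost}

/-- The elements with indices in `R` can be discarded when the values in `K` are known: no valid
element of `R` is smaller than all known values. -/
def CanDiscard (V : s.Evaluation δ) (K : Set ℝ) (R : Set (Fin (a + 1) × Fin (b + 1))) : Prop :=
  ∀ e ∈ R, V.Valid e.1 e.2 → ∃ r ∈ K, r ≤ V.M e.1 e.2

end Evaluation

end AngularOrder

/-- No four points of `P` lie on a circle. -/
def NoFourCocircular (P : Finset ℂ) : Prop :=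
  ∀ Q ⊆ P, Q.card = 4 → ¬ ∃ (c : ℂ) (r : ℝ), ∀ z ∈ Q, dist z c = r

end PCTC

/-! Suppose none of the three sets can be discarded. Then the column of [i, j] has valid entries
above and below it, and the row has one in front of it, all smaller than every known value. Let `f`
be the larger of the values below and in front; it is less than the costs at [i, j] and at the
element [i₀, j] that marks it in the column.

For a fixed positive side and radius, the possible negative centres form a convex set, `reach`. In a
BOS, each such centre for a radius below the cost is blocked by a boundary point of the negative
disk (`exists_inner_nonpos`): otherwise a small move towards it would lower the cost. At [i, j] the
solution below is blocked by a p-type point x and the one in front by a q-type point y. The entry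
above shows that the negative disk is not minimal, so by general position x and y are its only
boundary points and do all the blocking. At [i₀, j], the p-type dominating point k has a partner g
such that k and g already block everything (`exists_blocking_pair`, from the Helly-type
`exists_common_pos`).

The solutions below and in front have radii at most `f` and split these points as kx|gy and ky|gx.
This is impossible (`false_of_blocking_pairs`): by `exists_mem_inter_of_segments_below`, the convex
hull of their four centres would contain a point that neither x nor y blocks. -/

namespace PCTC

/-! ### Planar convexity: crossing segments and a Helly theorem for directions -/

/-- Two segments that pass below the points `a` and `b` respectively, where "below" is measured
by `u` along the level lines of `h`, meet up to replacing them by the triangles over `a`, `b`. -/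
theorem exists_mem_inter_of_segments_below (h u : ℂ →ₗ[ℝ] ℝ) {K₁ K₂ Q : Set ℂ}
    (hK₁ : Convex ℝ K₁) (hK₂ : Convex ℝ K₂) (hQ : Convex ℝ Q) {p₁ p₂ m₁ m₂ a b : ℂ}
    (hp₁ : p₁ ∈ K₁) (hm₁ : m₁ ∈ K₁) (ha : a ∈ K₁) (hp₂ : p₂ ∈ K₂) (hm₂ : m₂ ∈ K₂) (hb : b ∈ K₂)
    (qp₁ : p₁ ∈ Q) (qm₁ : m₁ ∈ Q) (qp₂ : p₂ ∈ Q) (qm₂ : m₂ ∈ Q)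
    (hma₁ : h m₁ < h a) (hma₂ : h m₂ < h a) (hmb₁ : h m₁ < h b) (hmb₂ : h m₂ < h b)
    (hap₁ : h a < h p₁) (hap₂ : h a < h p₂) (hbp₁ : h b < h p₁) (hbp₂ : h b < h p₂)
    (up₁a : u p₁ < u a) (um₁a : u m₁ < u a) (up₂a : u p₂ < u a) (um₂a : u m₂ < u a)
    (up₁b : u p₁ < u b) (um₁b : u m₁ < u b) :
    ∃ z ∈ Q, z ∈ K₁ ∧ z ∈ K₂ := by
  have coord : ∀ (g : ℂ →ₗ[ℝ] ℝ) (z : ℂ), g z = z.re * g 1 + z.im * g Complex.I := by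
    intro g z
    have : z = z.re • (1 : ℂ) + z.im • Complex.I := by
      simp [Complex.re_add_im]
    conv_lhs => rw [this]
    simp only [map_add, map_smul, smul_eq_mul]
  have inj : ∀ z w : ℂ, h z = h w → u z = u w → z = w := by
    intro z w e₁ e₂
    -- `h` and `u` are independent, so they serve as coordinates: otherwise `a`, whose level is
    -- between those of `m₁` and `p₁`, could not lie strictly above both in `u`.
    have hD : h 1 * u Complex.I - h Complex.I * u 1 ≠ 0 := by
      intro hD
      have key : (h m₁ - h a) * (u p₁ - u a) - (h p₁ - h a) * (u m₁ - u a) = 0 := by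
        rw [coord h m₁, coord h a, coord h p₁, coord u m₁, coord u a, coord u p₁]
        linear_combination ((m₁.re - a.re) * (p₁.im - a.im) -
          (m₁.im - a.im) * (p₁.re - a.re)) * hD
      nlinarith [mul_pos (sub_pos.2 hma₁) (sub_pos.2 up₁a), mul_pos (sub_pos.2 hap₁) (sub_pos.2 um₁a)]
    rw [coord h z, coord h w] at e₁
    rw [coord u z, coord u w] at e₂
    apply Complex.ext
    · apply mul_left_cancel₀ hD
      linear_combination u Complex.I * e₁ - h Complex.I * e₂
    · apply mul_left_cancel₀ hD
      linear_combination h 1 * e₂ - u 1 * e₁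
  have between : ∀ {K : Set ℂ}, Convex ℝ K → ∀ {x y z : ℂ}, x ∈ K → y ∈ K → h x = h y →
      h z = h x → u y ≤ u z → u z ≤ u x → z ∈ K := by
    intro K hK x y z hx hy e₁ e₂ l₁ l₂
    rcases eq_or_lt_of_le (l₁.trans l₂) with e | l
    · rwa [inj z x e₂ (le_antisymm l₂ (e ▸ l₁))]
    have hd : 0 < u x - u y := sub_pos.2 l
    have : z = ((u z - u y) / (u x - u y)) • x + ((u x - u z) / (u x - u y)) • y := by
      apply inj
      · simp only [map_add, map_smul, smul_eq_mul, ← e₁, e₂]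
        field_simp
        ring
      · simp only [map_add, map_smul, smul_eq_mul]
        field_simp
        ring
    rw [this]
    refine hK hx hy (div_nonneg (by linarith) hd.le) (div_nonneg (by linarith) hd.le) ?_
    field_simp
    ring
  have segm : ∀ m p : ℂ, h m < h p → ∃ s : ℝ → ℂ, Continuous s ∧ (∀ x, h (s x) = x) ∧
      (∀ x, h m < x → x < h p → ∀ K : Set ℂ, Convex ℝ K → m ∈ K → p ∈ K → s x ∈ K) ∧
      ∀ c, u m < c → u p < c → ∀ x, h m < x → x < h p → u (s x) < c := by
    intro m p l
    have hd : 0 < h p - h m := sub_pos.2 l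
    refine ⟨fun x => ((h p - x) / (h p - h m)) • m + ((x - h m) / (h p - h m)) • p,
      by fun_prop, ?_, ?_, ?_⟩
    · intro x
      simp only [map_add, map_smul, smul_eq_mul]
      field_simp
      ring
    · intro x l₁ l₂ K hK hm hp
      refine hK hm hp (div_nonneg (by linarith) hd.le) (div_nonneg (by linarith) hd.le) ?_
      field_simp
      ring
    · intro c c₁ c₂ x l₁ l₂
      simp only [map_add, map_smul, smul_eq_mul]
      have e₁ : 0 < (h p - x) / (h p - h m) := div_pos (by linarith) hd
      have e₂ : 0 < (x - h m) / (h p - h m) := div_pos (by linarith) hd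
      have e₃ : (h p - x) / (h p - h m) + (x - h m) / (h p - h m) = 1 := by
        field_simp
        ring
      calc _ < (h p - x) / (h p - h m) * c + (x - h m) / (h p - h m) * c :=
            add_lt_add (mul_lt_mul_of_pos_left c₁ e₁) (mul_lt_mul_of_pos_left c₂ e₂)
        _ = c := by rw [← add_mul, e₃, one_mul]
  obtain ⟨s₁, cs₁, hs₁, ks₁, us₁⟩ := segm m₁ p₁ (hma₁.trans hap₁)
  obtain ⟨s₂, cs₂, hs₂, ks₂, us₂⟩ := segm m₂ p₂ (hma₂.trans hap₂)
  -- If at the level of `b` the first segment is not below the second, its point there lies between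
  -- the second segment and `b`, hence in `K₂`. The level of `a` is symmetric. If both tests fail,
  -- the order of the segments changes between the two levels, so they cross.
  by_cases cA : u (s₂ (h b)) ≤ u (s₁ (h b))
  · exact ⟨s₁ (h b), ks₁ _ hmb₁ hbp₁ Q hQ qm₁ qp₁, ks₁ _ hmb₁ hbp₁ K₁ hK₁ hm₁ hp₁,
      between hK₂ hb (ks₂ _ hmb₂ hbp₂ K₂ hK₂ hm₂ hp₂) (hs₂ _).symm (hs₁ _) cA
        (us₁ _ um₁b up₁b _ hmb₁ hbp₁).le⟩
  by_cases cB : u (s₁ (h a)) ≤ u (s₂ (h a))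
  · exact ⟨s₂ (h a), ks₂ _ hma₂ hap₂ Q hQ qm₂ qp₂,
      between hK₁ ha (ks₁ _ hma₁ hap₁ K₁ hK₁ hm₁ hp₁) (hs₁ _).symm (hs₂ _) cB
        (us₂ _ um₂a up₂a _ hma₂ hap₂).le, ks₂ _ hma₂ hap₂ K₂ hK₂ hm₂ hp₂⟩
  push Not at cA cB
  have cont : Continuous fun x => u (s₁ x) - u (s₂ x) :=
    (u.continuous_of_finiteDimensional.comp cs₁).sub (u.continuous_of_finiteDimensional.comp cs₂)
  obtain ⟨x, hx, e⟩ := intermediate_value_uIcc (a := h b) (b := h a) cont.continuousOn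
    (show (0 : ℝ) ∈ uIcc _ _ from mem_uIcc.2 (Or.inl ⟨by linarith, by linarith⟩))
  have x₁ : h m₁ < x := lt_of_lt_of_le (lt_min hmb₁ hma₁) hx.1
  have x₂ : x < h p₁ := lt_of_le_of_lt hx.2 (max_lt hbp₁ hap₁)
  have x₃ : h m₂ < x := lt_of_lt_of_le (lt_min hmb₂ hma₂) hx.1
  have x₄ : x < h p₂ := lt_of_le_of_lt hx.2 (max_lt hbp₂ hap₂)
  have e' : s₁ x = s₂ x := inj _ _ ((hs₁ x).trans (hs₂ x).symm) (sub_eq_zero.1 e)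
  exact ⟨s₁ x, ks₁ _ x₁ x₂ Q hQ qm₁ qp₁, ks₁ _ x₁ x₂ K₁ hK₁ hm₁ hp₁,
    e' ▸ ks₂ _ x₃ x₄ K₂ hK₂ hm₂ hp₂⟩

/-- The signs of `y` and `z` decide. Both nonnegative would put 0 in `C`; otherwise the relation
expresses one of the three vectors as a nonnegative combination of the other two, and that vector
inherits the missing positivity. -/
theorem exists_common_pos_of_smul_add_eq_zero {C : Set ℂ} (hC : Convex ℝ C) (h0 : (0 : ℂ) ∉ C)
    {a b c : ℂ} (ha : a ∈ C) (hb : b ∈ C) (hc : c ∈ C) {φ₁ φ₂ φ₃ : ℂ →ₗ[ℝ] ℝ}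
    (a₂ : 0 < φ₂ a) (a₃ : 0 < φ₃ a) (b₁ : 0 < φ₁ b) (b₃ : 0 < φ₃ b)
    (c₁ : 0 < φ₁ c) (c₂ : 0 < φ₂ c) {x y z : ℝ} (hx : 0 < x)
    (e : x • a + y • b + z • c = 0) : ∃ z ∈ C, 0 < φ₁ z ∧ 0 < φ₂ z ∧ 0 < φ₃ z := by
  have e' : ∀ φ : ℂ →ₗ[ℝ] ℝ, x * φ a + y * φ b + z * φ c = 0 := fun φ => by
    simpa only [map_add, map_smul, smul_eq_mul, map_zero] using congrArg φ e
  rcases le_or_gt 0 y with hy | hy <;> rcases le_or_gt 0 z with hz | hz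
  · exfalso
    apply h0
    have := hC.sum_mem (t := Finset.univ) (w := ![x / (x + y + z), y / (x + y + z), z / (x + y + z)])
      (z := ![a, b, c]) (by intro i _; fin_cases i <;> simp <;> positivity)
      (by simp [Fin.sum_univ_three]; field_simp) (by intro i _; fin_cases i <;> simpa)
    convert this using 1
    simp only [Fin.sum_univ_three, Matrix.cons_val_zero, Matrix.cons_val_one, Matrix.cons_val]
    have : (x + y + z)⁻¹ • (x • a + y • b + z • c) = 0 := by rw [e, smul_zero]
    rw [← this]
    simp only [smul_add, smul_smul, div_eq_inv_mul]
  · refine ⟨c, hc, c₁, c₂, pos_of_mul_pos_right (a := -z) ?_ (by linarith)⟩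
    nlinarith [e' φ₃, mul_pos hx a₃, mul_nonneg hy b₃.le]
  · refine ⟨b, hb, b₁, pos_of_mul_pos_right (a := -y) ?_ (by linarith), b₃⟩
    nlinarith [e' φ₂, mul_pos hx a₂, mul_nonneg hz c₂.le]
  · refine ⟨a, ha, pos_of_mul_pos_right (a := x) ?_ hx.le, a₂, a₃⟩
    nlinarith [e' φ₁, mul_pos_of_neg_of_neg hy (neg_neg_of_pos b₁),
      mul_pos_of_neg_of_neg hz (neg_neg_of_pos c₁)]

/-- A form of Helly's theorem for directions: three linear functionals, any two of which are
positive at a common point of a plane convex set that misses the origin, are positive at a common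
point of it. -/
theorem exists_common_pos {C : Set ℂ} (hC : Convex ℝ C) (h0 : (0 : ℂ) ∉ C) {a b c : ℂ}
    (ha : a ∈ C) (hb : b ∈ C) (hc : c ∈ C) {φ₁ φ₂ φ₃ : ℂ →ₗ[ℝ] ℝ}
    (a₂ : 0 < φ₂ a) (a₃ : 0 < φ₃ a) (b₁ : 0 < φ₁ b) (b₃ : 0 < φ₃ b)
    (c₁ : 0 < φ₁ c) (c₂ : 0 < φ₂ c) :
    ∃ z ∈ C, 0 < φ₁ z ∧ 0 < φ₂ z ∧ 0 < φ₃ z := by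
  have hli : ¬ LinearIndependent ℝ ![a, b, c] := by
    intro hli
    have := hli.fintype_card_le_finrank
    simp [Complex.finrank_real_complex] at this
  rw [Fintype.linearIndependent_iff] at hli
  push Not at hli
  obtain ⟨g, hg, i, hi⟩ := hli
  wlog hpos : 0 < g i generalizing g
  · exact this (-g) (by simpa [Finset.sum_neg_distrib] using hg) (by simpa using hi)
      (by simpa using lt_of_le_of_ne (not_lt.1 hpos) hi)
  have e : g 0 • a + g 1 • b + g 2 • c = 0 := by simpa [Fin.sum_univ_three] using hg
  fin_cases i
  · exact exists_common_pos_of_smul_add_eq_zero hC h0 ha hb hc a₂ a₃ b₁ b₃ c₁ c₂ hpos e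
  · obtain ⟨z, hz, h₂, h₁, h₃⟩ := exists_common_pos_of_smul_add_eq_zero hC h0 hb ha hc
      b₁ b₃ a₂ a₃ c₂ c₁ (x := g 1) hpos (y := g 0) (z := g 2) (by rw [← e]; abel)
    exact ⟨z, hz, h₁, h₂, h₃⟩
  · obtain ⟨z, hz, h₃, h₁, h₂⟩ := exists_common_pos_of_smul_add_eq_zero hC h0 hc ha hb
      c₁ c₂ a₃ a₂ b₃ b₁ (x := g 2) hpos (y := g 0) (z := g 1) (by rw [← e]; abel)
    exact ⟨z, hz, h₁, h₂, h₃⟩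

/-! ### Reachable negative centres and inner-product estimates -/

/-- The points at distance at most `δ` from the centre of a disk of radius `ρ` that covers `S`. -/
def reach (δ : ℝ) (S : Set ℂ) (ρ : ℝ) : Set ℂ :=
  {z | ∃ p, dist p z ≤ δ ∧ ∀ x ∈ S, dist x p ≤ ρ}

theorem combo_mem_reach {δ ρ ρ' : ℝ} {S : Set ℂ} {z z' : ℂ} (hz : z ∈ reach δ S ρ)
    (hz' : z' ∈ reach δ S ρ') {s t : ℝ} (hs : 0 ≤ s) (ht : 0 ≤ t) (hst : s + t = 1) :
    s • z + t • z' ∈ reach δ S (s * ρ + t * ρ') := by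
  obtain ⟨p, hp, hpS⟩ := hz
  obtain ⟨p', hp', hpS'⟩ := hz'
  have key : ∀ {x y x' y' : ℂ} {c c' : ℝ}, dist x y ≤ c → dist x' y' ≤ c' →
      dist (s • x + t • x') (s • y + t • y') ≤ s * c + t * c' := by
    intro x y x' y' c c' h h'
    refine (dist_add_add_le _ _ _ _).trans (add_le_add ?_ ?_)
    · rw [dist_smul₀, Real.norm_of_nonneg hs]
      exact mul_le_mul_of_nonneg_left h hs
    · rw [dist_smul₀, Real.norm_of_nonneg ht]
      exact mul_le_mul_of_nonneg_left h' ht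
  refine ⟨s • p + t • p', ?_, fun x hx => ?_⟩
  · simpa only [← add_mul, hst, one_mul] using key hp hp'
  · have := key (hpS x hx) (hpS' x hx)
    rwa [← add_smul, hst, one_smul] at this

theorem convex_reach (δ : ℝ) (S : Set ℂ) (ρ : ℝ) : Convex ℝ (reach δ S ρ) := by
  intro z hz z' hz' s t hs ht hst
  simpa only [← add_mul, hst, one_mul] using combo_mem_reach hz hz' hs ht hst

/-- The positive centre is translated along with the negative one. -/
theorem add_mem_reach {δ ρ η : ℝ} {S : Set ℂ} {z w : ℂ} (hz : z ∈ reach δ S ρ) (hw : ‖w‖ ≤ η) :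
    z + w ∈ reach δ S (ρ + η) := by
  obtain ⟨p, hp, hpS⟩ := hz
  refine ⟨p + w, by simpa using hp, fun x hx => ?_⟩
  refine (dist_triangle x p _).trans (add_le_add (hpS x hx) ?_)
  simpa [dist_eq_norm] using hw

theorem reach_mono {δ ρ ρ' : ℝ} {S : Set ℂ} (h : ρ ≤ ρ') : reach δ S ρ ⊆ reach δ S ρ' :=
  fun _ ⟨p, hp, hpS⟩ => ⟨p, hp, fun x hx => (hpS x hx).trans h⟩

theorem dist_sq_eq (y z c : ℂ) :
    dist y z ^ 2 = dist y c ^ 2 - 2 * inner ℝ (y - c) (z - c) + ‖z - c‖ ^ 2 := by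
  rw [dist_eq_norm, dist_eq_norm, ← norm_sub_sq_real]
  congr 2
  ring

/-- Cauchy–Schwarz applied to `y - c` and `y - z`. -/
theorem mul_sub_le_inner {y z c : ℂ} {r ρ : ℝ} (hc : dist y c = r) (hz : dist y z ≤ ρ) :
    r * (r - ρ) ≤ inner ℝ (y - c) (z - c) := by
  have h₁ : inner ℝ (y - c) (y - z) ≤ r * ρ := by
    refine (real_inner_le_norm _ _).trans ?_
    rw [← dist_eq_norm, ← dist_eq_norm, hc]
    exact mul_le_mul_of_nonneg_left hz (hc ▸ dist_nonneg)
  have h₂ : inner ℝ (y - c) (y - c) = r * r := by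
    rw [real_inner_self_eq_norm_mul_norm, ← dist_eq_norm, hc]
  have h₃ : inner ℝ (y - c) (z - c) = inner ℝ (y - c) (y - c) - inner ℝ (y - c) (y - z) := by
    rw [← inner_sub_right]
    congr 1
    ring
  linarith

theorem inner_pos_of_dist_lt {y z c : ℂ} {r ρ : ℝ} (hc : dist y c = r) (hz : dist y z ≤ ρ)
    (hρ : ρ < r) : 0 < inner ℝ (y - c) (z - c) := by
  have hr : 0 < r := (dist_nonneg.trans hz).trans_lt hρ
  exact (mul_pos hr (sub_pos.2 hρ)).trans_le (mul_sub_le_inner hc hz)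

theorem inner_pos_of_dist_le {y z c : ℂ} (h : dist y z ≤ dist y c) (hne : z ≠ c) :
    0 < inner ℝ (y - c) (z - c) := by
  have h₁ : 0 < ‖z - c‖ ^ 2 := by
    have := norm_pos_iff.2 (sub_ne_zero.2 hne)
    positivity
  have h₂ : dist y z ^ 2 ≤ dist y c ^ 2 := pow_le_pow_left₀ dist_nonneg h 2
  linarith [dist_sq_eq y z c]

theorem exists_radius_of_forall_lt {T : Set ℂ} (hT : T.Finite) {g : ℂ → ℝ} {r : ℝ} (hr : 0 < r)
    (h : ∀ y ∈ T, g y < r) : ∃ ρ, 0 ≤ ρ ∧ ρ < r ∧ ∀ y ∈ T, g y ≤ ρ := by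
  rcases T.eq_empty_or_nonempty with rfl | hne
  · exact ⟨0, le_rfl, hr, by simp⟩
  · obtain ⟨y, hy, hmax⟩ := T.exists_max_image g hT hne
    exact ⟨max 0 (g y), le_max_left _ _, max_lt hr (h y hy),
      fun x hx => (hmax x hx).trans (le_max_right _ _)⟩

/-! ### Blocking points of a best optimal solution -/

namespace DiskPair.IsBOS

variable {D : DiskPair} {δ : ℝ} {S T : Set ℂ}

/-- A BOS cannot be improved by moving its centres towards the centres of a solution in which the
positive disk is smaller than the cost and the negative centre lies on the inner side of all
boundary points of the negative disk. -/
theorem exists_inner_nonpos (h : D.IsBOS δ S T) (hT : T.Finite) (hr : 0 < D.cost) {ρ : ℝ}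
    (hρ : ρ < D.cost) {z : ℂ} (hz : z ∈ reach δ S ρ) :
    ∃ y ∈ T, dist y D.neg.center = D.cost ∧
      inner ℝ (y - D.neg.center) (z - D.neg.center) ≤ 0 := by
  by_contra! H
  set c := D.neg.center with hc
  set r := D.cost with hrdef
  obtain ⟨⟨hS, hcov, hδ⟩, hopt⟩ := h
  have ev : ∀ y ∈ T, ∀ᶠ s : ℝ in nhdsWithin 0 (Ioi 0),
      dist y ((1 - s) • c + s • z) < r := by
    intro y hy
    rcases ((hcov y hy).trans (le_max_right _ _ : _ ≤ r)).lt_or_eq with hlt | heq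
    · have cont : Continuous fun s : ℝ => dist y ((1 - s) • c + s • z) := by fun_prop
      have := cont.tendsto 0
      simp only [sub_zero, one_smul, zero_smul, add_zero] at this
      exact (this.eventually_lt_const hlt).filter_mono nhdsWithin_le_nhds
    · replace heq : dist y c = r := heq
      -- To first order in `s`, the squared distance to a boundary point changes by `-2 * s` times
      -- this positive inner product.
      have hi := H y hy heq
      have cont : Continuous fun s : ℝ => s * ‖z - c‖ ^ 2 := by fun_prop
      have := cont.tendsto 0
      rw [zero_mul] at this
      filter_upwards [(this.eventually_lt_const (mul_pos two_pos hi)).filter_mono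
        nhdsWithin_le_nhds, self_mem_nhdsWithin] with s hs hs0
      rw [mem_Ioi] at hs0
      have e : (1 - s) • c + s • z - c = s • (z - c) := by
        rw [sub_smul, one_smul, smul_sub]; abel
      have key := dist_sq_eq y ((1 - s) • c + s • z) c
      rw [e, inner_smul_right, norm_smul, Real.norm_of_nonneg hs0.le, mul_pow, heq] at key
      refine lt_of_pow_lt_pow_left₀ 2 hr.le ?_
      nlinarith [mul_lt_mul_of_pos_left hs hs0]
  have ev' : ∀ᶠ s : ℝ in nhdsWithin 0 (Ioi 0), s < 1 :=
    (eventually_lt_nhds one_pos).filter_mono nhdsWithin_le_nhds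
  obtain ⟨s, ⟨hs, hs1⟩, hs0⟩ := (((Filter.eventually_all_finite hT).2 ev).and ev').and
    self_mem_nhdsWithin |>.exists
  obtain ⟨ρ', hρ0, hρ', hT'⟩ := exists_radius_of_forall_lt hT hr hs
  -- `c` is reachable with radius `r`, so moving by the fraction `s` towards `z` gives a positive
  -- radius strictly below `r`.
  have hc' : c ∈ reach δ S r :=
    ⟨D.pos.center, hδ, fun x hx => (hS x hx).trans (le_max_left _ _)⟩
  obtain ⟨p, hp, hpS⟩ := combo_mem_reach hc' hz (sub_nonneg.2 hs1.le) hs0.le (by ring)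
  have hlt : (1 - s) * r + s * ρ < r := by nlinarith
  have hm : 0 ≤ max ρ' ((1 - s) * r + s * ρ) := hρ0.trans (le_max_left _ _)
  have := (hopt ⟨⟨p, _, hm⟩, ⟨(1 - s) • c + s • z, _, hm⟩⟩
    ⟨fun x hx => (hpS x hx).trans (le_max_right _ _),
      fun y hy => (hT' y hy).trans (le_max_left _ _), hp⟩).1
  simp only [DiskPair.cost, max_self] at this
  exact absurd (max_lt hρ' hlt) (not_lt.2 this)

/-- This is where the second criterion of a BOS enters: shrinking only the positive disk keeps the
cost but lowers the smaller radius. -/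
theorem center_notMem_reach (h : D.IsBOS δ S T) (hr : 0 < D.cost) (hpos : D.pos.radius = D.cost)
    (hneg : D.neg.radius = D.cost) {ρ : ℝ} (hρ : ρ < D.cost) :
    D.neg.center ∉ reach δ S ρ := by
  rintro ⟨p, hp, hpS⟩
  have hlt : max 0 ρ < D.cost := max_lt hr hρ
  have := (h.2 ⟨⟨p, max 0 ρ, le_max_left _ _⟩, D.neg⟩
    ⟨fun x hx => (hpS x hx).trans (le_max_right _ _), h.1.2.1, hp⟩).2
    (by rw [DiskPair.cost, hneg]; exact max_eq_right hlt.le)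
  simp only [DiskPair.smallRadius, hpos, hneg, min_self] at this
  exact absurd (this.trans (min_le_left _ _)) (not_le.2 hlt)

/-- A dominating point of the negative disk of a BOS is the only boundary point that hinders an
improvement. -/
theorem exists_improvement_of_negDominating (h : D.IsBOS δ S T) (hT : T.Finite) (hr : 0 < D.cost)
    (hpos : D.pos.radius = D.cost) (hneg : D.neg.radius = D.cost) {k : ℂ}
    (hk : D.NegDominating δ S T k) {f : ℝ} (hf : f < D.cost) {m : ℂ} (hm : m ∈ reach δ S f) :
    ∃ ρ < D.cost, ∃ e ∈ reach δ S ρ, ∀ y ∈ T, y ≠ k → dist y D.neg.center = D.cost →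
      0 < inner ℝ (y - D.neg.center) (e - D.neg.center) := by
  obtain ⟨E, ⟨hES, hET, hEδ⟩, hE, hE'⟩ : ∃ E : DiskPair, E.IsSolution δ S (T \ {k}) ∧
      E.cost ≤ D.cost ∧ (E.pos.radius < D.cost ∨ E.neg.radius < D.cost) := by
    -- Without such an `E`, the pair `D` would remain a BOS after the removal of `k`.
    by_contra! H
    refine hk.2 ⟨⟨h.1.1, fun y hy => h.1.2.1 y hy.1, h.1.2.2⟩, fun E hE => ?_⟩
    rcases le_or_gt E.cost D.cost with hc | hc
    · obtain ⟨h₁, h₂⟩ := H E hE hc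
      refine ⟨h₁.trans (le_max_left _ _), fun _ => ?_⟩
      rw [DiskPair.smallRadius, hpos, hneg, min_self]
      exact le_min h₁ h₂
    · exact ⟨hc.le, fun e => absurd e hc.ne'⟩
  have hEp : E.pos.radius ≤ D.cost := (le_max_left _ _).trans hE
  have hEn : E.neg.radius ≤ D.cost := (le_max_right _ _).trans hE
  set c := D.neg.center with hc
  by_cases hec : E.neg.center = c
  · rcases hE' with h' | h'
    · exact absurd (hec ▸ ⟨E.pos.center, hEδ, fun x hx => hES x hx⟩ : c ∈ reach δ S E.pos.radius)
        (h.center_notMem_reach hr hpos hneg h')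
    -- Here `k` is the only possible boundary point, so the positivity claim is vacuous and any
    -- reachable centre serves.
    · refine ⟨f, hf, m, hm, fun y hy hyk hyc => ?_⟩
      have := hET y ⟨hy, hyk⟩
      rw [hec, hyc] at this
      exact absurd this (not_le.2 h')
  -- `E` may use the full radius `D.cost` on the positive side; a small push towards `m` makes it
  -- strictly smaller and preserves the strict inequalities.
  · have ev : ∀ y ∈ T, ∀ᶠ s : ℝ in nhdsWithin 0 (Ioi 0), y ≠ k → dist y c = D.cost →
        0 < inner ℝ (y - c) ((1 - s) • E.neg.center + s • m - c) := by
      intro y hy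
      by_cases hyk : y ≠ k ∧ dist y c = D.cost
      · have hi : 0 < inner ℝ (y - c) (E.neg.center - c) :=
          inner_pos_of_dist_le (((hET y ⟨hy, hyk.1⟩).trans hEn).trans hyk.2.ge) hec
        have cont : Continuous fun s : ℝ =>
            inner ℝ (y - c) ((1 - s) • E.neg.center + s • m - c) := by fun_prop
        have := cont.tendsto 0
        simp only [sub_zero, one_smul, zero_smul, add_zero] at this
        filter_upwards [(this.eventually_const_lt hi).filter_mono nhdsWithin_le_nhds]
          with s hs _ _ using hs
      · exact Filter.Eventually.of_forall fun s h₁ h₂ => absurd ⟨h₁, h₂⟩ hyk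
    have ev' : ∀ᶠ s : ℝ in nhdsWithin 0 (Ioi 0), s < 1 :=
      (eventually_lt_nhds one_pos).filter_mono nhdsWithin_le_nhds
    obtain ⟨s, ⟨hs, hs1⟩, hs0⟩ := (((Filter.eventually_all_finite hT).2 ev).and ev').and
      self_mem_nhdsWithin |>.exists
    have hEr : E.neg.center ∈ reach δ S D.cost :=
      ⟨E.pos.center, hEδ, fun x hx => (hES x hx).trans hEp⟩
    exact ⟨_, by nlinarith, _, combo_mem_reach hEr hm (sub_nonneg.2 hs1.le) hs0.le (by ring), hs⟩

/-- If at most three points lie on the boundary of the negative disk of a BOS, then every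
dominating point of that disk lies on its boundary, together with a point such that these two
already prevent every improvement. -/
theorem exists_blocking_pair (h : D.IsBOS δ S T) (hT : T.Finite) (hr : 0 < D.cost)
    (hpos : D.pos.radius = D.cost) (hneg : D.neg.radius = D.cost) {k : ℂ}
    (hk : D.NegDominating δ S T k) {f : ℝ} (hf : f < D.cost) {m : ℂ} (hm : m ∈ reach δ S f)
    (hcard : ∀ Q : Finset ℂ, (Q : Set ℂ) ⊆ T → (∀ y ∈ Q, dist y D.neg.center = D.cost) →
      Q.card ≠ 4) :
    dist k D.neg.center = D.cost ∧ ∃ g ∈ T, dist g D.neg.center = D.cost ∧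
      ∀ ρ < D.cost, ∀ z ∈ reach δ S ρ, 0 < inner ℝ (k - D.neg.center) (z - D.neg.center) →
        inner ℝ (g - D.neg.center) (z - D.neg.center) ≤ 0 := by
  obtain ⟨ρe, hρe, e, he, hpose⟩ :=
    h.exists_improvement_of_negDominating hT hr hpos hneg hk hf hm
  set c := D.neg.center with hc
  have hkc : dist k c = D.cost := by
    obtain ⟨y, hy, hyc, hyi⟩ := h.exists_inner_nonpos hT hr hρe he
    by_cases hyk : y = k
    · exact hyk ▸ hyc
    · exact absurd hyi (not_le.2 (hpose y hy hyk hyc))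
  refine ⟨hkc, ?_⟩
  -- By `hcard` there are at most two boundary points besides `k`; missing ones are filled in by
  -- repetition.
  have three : ∃ g g', (g ∈ T ∧ dist g c = D.cost) ∧ (g' ∈ T ∧ dist g' c = D.cost) ∧
      ∀ y ∈ T, dist y c = D.cost → y = k ∨ y = g ∨ y = g' := by
    by_cases h₁ : ∃ g, (g ∈ T ∧ dist g c = D.cost) ∧ g ≠ k
    · obtain ⟨g, hg, hgk⟩ := h₁
      by_cases h₂ : ∃ g', (g' ∈ T ∧ dist g' c = D.cost) ∧ g' ≠ k ∧ g' ≠ g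
      · obtain ⟨g', hg', hgk', hgg'⟩ := h₂
        refine ⟨g, g', hg, hg', fun y hy hyc => ?_⟩
        by_contra! hne
        apply hcard {k, g, g', y}
        · intro x hx
          simp only [Finset.coe_insert, Finset.coe_singleton, mem_insert_iff,
            mem_singleton_iff] at hx
          rcases hx with rfl | rfl | rfl | rfl
          exacts [hk.1, hg.1, hg'.1, hy]
        · intro x hx
          simp only [Finset.mem_insert, Finset.mem_singleton] at hx
          rcases hx with rfl | rfl | rfl | rfl
          exacts [hkc, hg.2, hg'.2, hyc]
        · rw [Finset.card_insert_of_notMem, Finset.card_insert_of_notMem,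
            Finset.card_insert_of_notMem, Finset.card_singleton]
          · simpa using hne.2.2.symm
          · simpa using ⟨hgg'.symm, hne.2.1.symm⟩
          · simpa using ⟨hgk.symm, hgk'.symm, hne.1.symm⟩
      · push Not at h₂
        exact ⟨g, g, hg, hg, fun y hy hyc => by
          by_cases hyk : y = k
          · exact Or.inl hyk
          · exact Or.inr (Or.inl (h₂ y ⟨hy, hyc⟩ hyk))⟩
    · push Not at h₁
      exact ⟨k, k, ⟨hk.1, hkc⟩, ⟨hk.1, hkc⟩, fun y hy hyc => Or.inl (h₁ y ⟨hy, hyc⟩)⟩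
  obtain ⟨g, g', ⟨hg, hgc⟩, ⟨hg', hgc'⟩, hall⟩ := three
  by_contra! H
  obtain ⟨ρb, hρb, b, hb, b₁, b₂⟩ := H g hg hgc
  obtain ⟨ρd, hρd, d, hd, d₁, d₂⟩ := H g' hg' hgc'
  have block : ∀ ρ < D.cost, ∀ z ∈ reach δ S ρ, 0 < inner ℝ (k - c) (z - c) →
      0 < inner ℝ (g - c) (z - c) → 0 < inner ℝ (g' - c) (z - c) → False := by
    intro ρ hρ z hz h₁ h₂ h₃
    obtain ⟨y, hy, hyc, hyi⟩ := h.exists_inner_nonpos hT hr hρ hz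
    rcases hall y hy hyc with rfl | rfl | rfl
    exacts [not_le.2 h₁ hyi, not_le.2 h₂ hyi, not_le.2 h₃ hyi]
  by_cases hgk : g = k
  · exact block ρd hρd d hd d₁ (hgk ▸ d₁) d₂
  by_cases hgk' : g' = k
  · exact block ρb hρb b hb b₁ b₂ (hgk' ▸ b₁)
  set ρ := max ρe (max ρb ρd) with hρdef
  have hρ : ρ < D.cost := max_lt hρe (max_lt hρb hρd)
  have hC : Convex ℝ {w : ℂ | w + c ∈ reach δ S ρ} := by
    intro x hx y hy s t hs ht hst
    have := convex_reach δ S ρ hx hy hs ht hst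
    rw [smul_add, smul_add, add_add_add_comm, ← add_smul, hst, one_smul] at this
    exact this
  -- `e` is unblocked by `g` and `g'`, `b` by `k` and `g`, `d` by `k` and `g'`; Helly yields a
  -- centre that no boundary point blocks.
  obtain ⟨z, hz, h₁, h₃, h₂⟩ := exists_common_pos (a := e - c) (b := b - c) (c := d - c) hC
    (by simpa using h.center_notMem_reach hr hpos hneg hρ)
    (by simpa using reach_mono (le_max_left _ _) he)
    (by simpa using reach_mono ((le_max_left _ _).trans (le_max_right _ _)) hb)
    (by simpa using reach_mono ((le_max_right _ _).trans (le_max_right _ _)) hd)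
    (φ₁ := innerₗ ℂ (k - c)) (φ₂ := innerₗ ℂ (g' - c)) (φ₃ := innerₗ ℂ (g - c))
    (hpose g' hg' hgk' hgc') (hpose g hg hgk hgc) b₁ b₂ d₁ d₂
  rw [innerₗ_apply_apply] at h₁ h₂ h₃
  exact block ρ hρ (z + c) hz (by rwa [add_sub_cancel_right]) (by rwa [add_sub_cancel_right])
    (by rwa [add_sub_cancel_right])

end DiskPair.IsBOS

/-! ### The impossible four-point configuration -/

/-- Two pairs of centres `(p₁, m₁)` and `(p₂, m₂)` for the radius `f` cannot divide the four points
`k`, `x`, `g`, `y` as `kx|gy` and `ky|gx` if for larger radii `x`, `y` are a blocking pair of the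
disk centred at `c` and `k`, `g` are a blocking pair of a disk that covers `x` and `y`. -/
theorem false_of_blocking_pairs {δ f r R : ℝ} {S S' : Set ℂ} {c o k g x y p₁ m₁ p₂ m₂ : ℂ}
    (hfr : f < r) (hfR : f < R)
    (hxc : dist x c = r) (hyc : dist y c = r) (hxo : dist x o ≤ R) (hyo : dist y o ≤ R)
    (hblock : ∀ z ∈ reach δ S f, 0 < inner ℝ (x - c) (z - c) → inner ℝ (y - c) (z - c) ≤ 0)
    (hko : dist k o = R) (hgo : dist g o = R)
    (ho : ∀ ρ < R, o ∉ reach δ S' ρ)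
    (hblock' : ∀ ρ < R, ∀ z ∈ reach δ S' ρ, 0 < inner ℝ (k - o) (z - o) →
      inner ℝ (g - o) (z - o) ≤ 0)
    (hpm₁ : dist p₁ m₁ ≤ δ) (hpm₂ : dist p₂ m₂ ≤ δ)
    (hS₁ : ∀ s ∈ S, dist s p₁ ≤ f) (hS₂ : ∀ s ∈ S, dist s p₂ ≤ f)
    (hS'₁ : ∀ s ∈ S', dist s p₁ ≤ f) (hS'₂ : ∀ s ∈ S', dist s p₂ ≤ f)
    (kp₁ : dist k p₁ ≤ f) (kp₂ : dist k p₂ ≤ f) (gm₁ : dist g m₁ ≤ f) (gm₂ : dist g m₂ ≤ f)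
    (xp₁ : dist x p₁ ≤ f) (ym₁ : dist y m₁ ≤ f) (yp₂ : dist y p₂ ≤ f) (xm₂ : dist x m₂ ≤ f) :
    False := by
  have hf : 0 ≤ f := dist_nonneg.trans kp₁
  have hr : 0 < r := hf.trans_lt hfr
  have hR : 0 < R := hf.trans_lt hfR
  have hδ : 0 ≤ δ := dist_nonneg.trans hpm₁
  -- `η < R - f` keeps the `η`-ball around `o` away from the hull of the centres; `η > R - r` places
  -- the points `a`, `b` of that ball in the open half-planes of `x` and `y`.
  obtain ⟨η, hη, hηf⟩ : ∃ η, max 0 (R - r) < η ∧ η < R - f :=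
    exists_between (max_lt (by linarith) (by linarith))
  have hη0 : 0 < η := (le_max_left _ _).trans_lt hη
  have hηr : R - r < η := (le_max_right _ _).trans_lt hη
  have half : ∀ v : ℂ, Convex ℝ {z : ℂ | 0 < inner ℝ (v - c) (z - c)} := by
    intro v
    have : {z : ℂ | 0 < inner ℝ (v - c) (z - c)} =
        {z : ℂ | inner ℝ (v - c) c < innerₗ ℂ (v - c) z} := by
      ext z
      simp only [mem_ofPred_eq, innerₗ_apply_apply, inner_sub_right, sub_pos]
    rw [this]
    exact convex_halfSpace_gt (innerₗ ℂ (v - c)).isLinear _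
  have apex : ∀ v : ℂ, dist v c = r → dist v o ≤ R →
      0 < inner ℝ (v - c) (o + (η / r) • (v - c) - c) ∧ dist (o + (η / r) • (v - c)) o = η := by
    intro v hvc hvo
    have hn : ‖v - c‖ = r := by rw [← dist_eq_norm, hvc]
    constructor
    · have e : o + (η / r) • (v - c) - c = (o - c) + (η / r) • (v - c) := by abel
      have h₁ := mul_sub_le_inner hvc hvo
      rw [e, inner_add_right, inner_smul_right, real_inner_self_eq_norm_mul_norm, hn]
      have : η / r * (r * r) = r * η := by field_simp
      rw [this]
      nlinarith [mul_pos hr (sub_pos.2 hηr)]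
    · rw [dist_eq_norm, add_sub_cancel_left, norm_smul, hn, Real.norm_of_nonneg (by positivity)]
      field_simp
  obtain ⟨ha, hao⟩ := apex x hxc hxo
  obtain ⟨hb, hbo⟩ := apex y hyc hyo
  set a := o + (η / r) • (x - c)
  set b := o + (η / r) • (y - c)
  have sub : ∀ {U : Set ℂ}, (∀ s ∈ U, dist s p₁ ≤ f) → (∀ s ∈ U, dist s p₂ ≤ f) →
      convexHull ℝ {p₁, m₁, p₂, m₂} ⊆ reach δ U f := by
    intro U h₁ h₂
    refine convexHull_min ?_ (convex_reach δ U f)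
    rintro z (rfl | rfl | rfl | rfl)
    exacts [⟨z, by simpa, h₁⟩, ⟨p₁, hpm₁, h₁⟩, ⟨z, by simpa, h₂⟩, ⟨p₂, hpm₂, h₂⟩]
  -- A hull point within `η` of `o` could be translated to `o`, which would be reachable with radius
  -- `f + η < R`.
  have hdisj : Disjoint (convexHull ℝ ({p₁, m₁, p₂, m₂} : Set ℂ)) (Metric.closedBall o η) := by
    rw [Set.disjoint_left]
    intro z hz hzo
    have := add_mem_reach (sub hS'₁ hS'₂ hz) (w := o - z)
      (by rwa [← dist_eq_norm, dist_comm, ← Metric.mem_closedBall])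
    rw [add_sub_cancel] at this
    exact ho _ (by linarith) this
  obtain ⟨u, v₁, v₂, hu₁, hv, hu₂⟩ := geometric_hahn_banach_compact_closed
    (convex_convexHull ℝ _) ((Set.toFinite ({p₁, m₁, p₂, m₂} : Set ℂ)).isCompact_convexHull ℝ)
    (convex_closedBall o η) Metric.isClosed_closedBall hdisj
  have below : ∀ q ∈ ({p₁, m₁, p₂, m₂} : Set ℂ), ∀ w, dist w o = η → u q < u w := fun q hq w hw =>
    ((hu₁ q (subset_convexHull ℝ _ hq)).trans hv).trans (hu₂ w (Metric.mem_closedBall.2 hw.le))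
  have hk : ‖k - o‖ = R := by rw [← dist_eq_norm, hko]
  have hleft : ∀ w, dist w o = η → -(R * η) ≤ inner ℝ (k - o) (w - o) ∧
      inner ℝ (k - o) (w - o) ≤ R * η := by
    intro w hw
    have := abs_real_inner_le_norm (k - o) (w - o)
    rwa [hk, ← dist_eq_norm, hw, abs_le] at this
  have hp : ∀ {p}, dist k p ≤ f → R * η < inner ℝ (k - o) (p - o) := fun h =>
    (mul_lt_mul_of_pos_left hηf hR).trans_le (mul_sub_le_inner hko h)
  -- Shift `m` by some `θ` between `η` and `R - f` in the direction of `k - o`. It stays reachable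
  -- below `R` and unblocked by `g`, so `k` must block it; hence `m` itself lies far on the other
  -- side.
  have hm : ∀ {m}, m ∈ ({p₁, m₁, p₂, m₂} : Set ℂ) → dist g m ≤ f →
      inner ℝ (k - o) (m - o) < -(R * η) := by
    intro m hmem hgm
    obtain ⟨θ, hθ, hθf⟩ := exists_between hηf
    have hθ0 : 0 < θ := hη0.trans hθ
    have hw : ‖(θ / R) • (k - o)‖ = θ := by
      rw [norm_smul, hk, Real.norm_of_nonneg (by positivity)]
      field_simp
    have e : m + (θ / R) • (k - o) - o = (m - o) + (θ / R) • (k - o) := by abel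
    have hgn : ‖g - o‖ = R := by rw [← dist_eq_norm, hgo]
    have hg : 0 < inner ℝ (g - o) (m + (θ / R) • (k - o) - o) := by
      have h₁ := mul_sub_le_inner hgo hgm
      have h₂ := abs_real_inner_le_norm (g - o) ((θ / R) • (k - o))
      rw [hw, hgn, abs_le] at h₂
      rw [e, inner_add_right]
      nlinarith [mul_lt_mul_of_pos_left hθf hR]
    have hkm := not_lt.1 fun h => not_le.2 hg (hblock' (f + θ) (by linarith) _
      (add_mem_reach (sub hS'₁ hS'₂ (subset_convexHull ℝ _ hmem)) hw.le) h)
    rw [e, inner_add_right, inner_smul_right, real_inner_self_eq_norm_mul_norm, hk] at hkm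
    have : θ / R * (R * R) = R * θ := by field_simp
    nlinarith [mul_lt_mul_of_pos_left hθ hR]
  have hlt : ∀ {m w p}, m ∈ ({p₁, m₁, p₂, m₂} : Set ℂ) → dist g m ≤ f → dist w o = η →
      dist k p ≤ f → innerₗ ℂ (k - o) m < innerₗ ℂ (k - o) w ∧
        innerₗ ℂ (k - o) w < innerₗ ℂ (k - o) p := by
    intro m w p hmem hgm hw hkp
    have h₁ := (hm hmem hgm).trans_le (hleft w hw).1
    have h₂ := (hleft w hw).2.trans_lt (hp hkp)
    rw [inner_sub_right, inner_sub_right, sub_lt_sub_iff_right] at h₁ h₂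
    exact ⟨h₁, h₂⟩
  have i₁ : p₁ ∈ ({p₁, m₁, p₂, m₂} : Set ℂ) := by simp
  have j₁ : m₁ ∈ ({p₁, m₁, p₂, m₂} : Set ℂ) := by simp
  have i₂ : p₂ ∈ ({p₁, m₁, p₂, m₂} : Set ℂ) := by simp
  have j₂ : m₂ ∈ ({p₁, m₁, p₂, m₂} : Set ℂ) := by simp
  -- The segments join centres of different solutions: `p₁` and `m₂` are both close to `x`, `p₂` and
  -- `m₁` to `y`.
  obtain ⟨z, hz, hz₁, hz₂⟩ := exists_mem_inter_of_segments_below (innerₗ ℂ (k - o))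
    (u : ℂ →ₗ[ℝ] ℝ) (half x) (half y) (convex_convexHull ℝ {p₁, m₁, p₂, m₂})
    (p₁ := p₁) (m₁ := m₂) (p₂ := p₂) (m₂ := m₁) (a := a) (b := b)
    (inner_pos_of_dist_lt hxc xp₁ hfr) (inner_pos_of_dist_lt hxc xm₂ hfr) ha
    (inner_pos_of_dist_lt hyc yp₂ hfr) (inner_pos_of_dist_lt hyc ym₁ hfr) hb
    (subset_convexHull ℝ _ i₁) (subset_convexHull ℝ _ j₂)
    (subset_convexHull ℝ _ i₂) (subset_convexHull ℝ _ j₁)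
    (hlt j₂ gm₂ hao kp₁).1 (hlt j₁ gm₁ hao kp₁).1 (hlt j₂ gm₂ hbo kp₁).1 (hlt j₁ gm₁ hbo kp₁).1
    (hlt j₁ gm₁ hao kp₁).2 (hlt j₁ gm₁ hao kp₂).2 (hlt j₁ gm₁ hbo kp₁).2 (hlt j₁ gm₁ hbo kp₂).2
    (below _ i₁ _ hao) (below _ j₂ _ hao) (below _ i₂ _ hao) (below _ j₁ _ hao)
    (below _ i₁ _ hbo) (below _ j₂ _ hbo)
  exact absurd (hblock z (sub hS₁ hS₂ hz) hz₁) (not_le.2 hz₂)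

/-! ### Monotonicity of the partitions -/

namespace AngularOrder

variable {P : Finset ℂ} {m u : ℂ} {a b : ℕ} (s : AngularOrder P m u a b)

theorem p_mem (k : Fin a) : s.p k ∈ P := (s.range_p.subset (mem_range_self k)).1

theorem q_mem (k : Fin b) : s.q k ∈ P := (s.range_q.subset (mem_range_self k)).1

theorem p_injective : Function.Injective s.p := fun _ _ h =>
  s.strictMono_p.injective (by simp only [h])

theorem p_ne_q (k : Fin a) (l : Fin b) : s.p k ≠ s.q l := by
  intro h
  have h₁ := (s.range_p.subset (mem_range_self k)).2
  have h₂ := (s.range_q.subset (mem_range_self l)).2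
  rw [h] at h₁
  exact lt_asymm h₁ h₂

theorem negSide_subset (i : Fin (a + 1)) (j : Fin (b + 1)) : s.negSide i j ⊆ P := by
  rintro z (⟨k, -, rfl⟩ | ⟨k, -, rfl⟩)
  exacts [s.p_mem k, s.q_mem k]

theorem negSide_finite (i : Fin (a + 1)) (j : Fin (b + 1)) : (s.negSide i j).Finite :=
  P.finite_toSet.subset (s.negSide_subset i j)

theorem posSide_mono {i i' : Fin (a + 1)} {j j' : Fin (b + 1)} (hi : i ≤ i') (hj : j ≤ j') :
    s.posSide i j ⊆ s.posSide i' j' := by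
  rintro z (⟨k, hk, rfl⟩ | ⟨k, hk, rfl⟩)
  · exact Or.inl ⟨k, hk.trans_le hi, rfl⟩
  · exact Or.inr ⟨k, hk.trans_le hj, rfl⟩

theorem negSide_anti {i i' : Fin (a + 1)} {j j' : Fin (b + 1)} (hi : i ≤ i') (hj : j ≤ j') :
    s.negSide i' j' ⊆ s.negSide i j := by
  rintro z (⟨k, hk, rfl⟩ | ⟨k, hk, rfl⟩)
  · exact Or.inl ⟨k, le_trans hi hk, rfl⟩
  · exact Or.inr ⟨k, le_trans hj hk, rfl⟩

theorem mem_posSide_or_mem_negSide {i : Fin (a + 1)} {j : Fin (b + 1)} (i' : Fin (a + 1))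
    (j' : Fin (b + 1)) {z : ℂ} (hz : z ∈ s.negSide i j) :
    z ∈ s.posSide i' j' ∨ z ∈ s.negSide i' j' := by
  rcases hz with ⟨k, -, rfl⟩ | ⟨k, -, rfl⟩
  · rcases lt_or_ge (k : ℕ) i' with h | h
    exacts [Or.inl (Or.inl ⟨k, h, rfl⟩), Or.inr (Or.inl ⟨k, h, rfl⟩)]
  · rcases lt_or_ge (k : ℕ) j' with h | h
    exacts [Or.inl (Or.inr ⟨k, h, rfl⟩), Or.inr (Or.inr ⟨k, h, rfl⟩)]

theorem exists_p_of_mem_negSide_of_notMem {i i' : Fin (a + 1)} {j : Fin (b + 1)} {z : ℂ}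
    (hz : z ∈ s.negSide i j) (hz' : z ∉ s.negSide i' j) :
    ∃ k : Fin a, (i : ℕ) ≤ k ∧ (k : ℕ) < i' ∧ z = s.p k := by
  rcases hz with ⟨k, hk, rfl⟩ | ⟨k, hk, rfl⟩
  · exact ⟨k, hk, not_le.1 fun h => hz' (Or.inl ⟨k, h, rfl⟩), rfl⟩
  · exact absurd (Or.inr ⟨k, hk, rfl⟩) hz'

theorem exists_q_of_mem_negSide_of_notMem {i : Fin (a + 1)} {j j' : Fin (b + 1)} {z : ℂ}
    (hz : z ∈ s.negSide i j) (hz' : z ∉ s.negSide i j') :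
    ∃ k : Fin b, (j : ℕ) ≤ k ∧ (k : ℕ) < j' ∧ z = s.q k := by
  rcases hz with ⟨k, hk, rfl⟩ | ⟨k, hk, rfl⟩
  · exact absurd (Or.inl ⟨k, hk, rfl⟩) hz'
  · exact ⟨k, hk, not_le.1 fun h => hz' (Or.inr ⟨k, h, rfl⟩), rfl⟩

end AngularOrder
end PCTC

/-! ### Assembling the configuration -/

open PCTC

theorem mainTheorem2
    (P : Finset ℂ) (δ : ℝ) (hδ : 0 ≤ δ) (hP : PCTC.NoFourCocircular P)
    (m : ℂ) (hm : m ∈ convexHull ℝ (P : Set ℂ)) (u : ℂ) (hu : u ≠ 0)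
    (a b : ℕ) (s : PCTC.AngularOrder P m u a b)
    (V : s.Evaluation δ) (hV : V.Generic)
    (T B : Set (Fin (a + 1) × Fin (b + 1)))
    (i : Fin (a + 1)) (j : Fin (b + 1)) (hij : V.DoublyMarked T B i j) :
    V.CanDiscard (V.knownValues (T ∪ B) i j) {e | e.1 ≤ i ∧ e.2 = j} ∨
      V.CanDiscard (V.knownValues (T ∪ B) i j) {e | i ≤ e.1 ∧ e.2 = j} ∨
      V.CanDiscard (V.knownValues (T ∪ B) i j) {e | e.1 = i ∧ j ≤ e.2} := by
  by_contra! H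
  obtain ⟨H₁, H₂, H₃⟩ := H
  simp only [AngularOrder.Evaluation.CanDiscard] at H₁ H₂ H₃
  push Not at H₁ H₂ H₃
  obtain ⟨⟨i₁, j₁⟩, ⟨hi₁, e₁⟩, v₁, K₁⟩ := H₁
  obtain ⟨⟨i₂, j₂⟩, ⟨hi₂, e₂⟩, v₂, K₂⟩ := H₂
  obtain ⟨⟨i₃, j₃⟩, ⟨e₃, hj₃⟩, v₃, K₃⟩ := H₃
  dsimp only at hi₁ e₁ v₁ K₁ hi₂ e₂ v₂ K₂ e₃ hj₃ v₃ K₃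
  subst j₁ j₂ i₃
  obtain ⟨⟨i₀, hT, vY, -, -, -, κ, hκ, hκi⟩, -⟩ := hij
  have kX : (V.D i j).cost ∈ V.knownValues (T ∪ B) i j := Or.inr rfl
  have kY : V.M i₀ j ∈ V.knownValues (T ∪ B) i j := Or.inl ⟨(i₀, j), Or.inl hT, vY, rfl⟩
  have hX := V.isBOS i j
  have hY := V.isBOS i₀ j
  -- With 0-based indices, this puts `s.p κ` on the positive side of [i, j], while it is on the
  -- negative side of [i₀, j].
  have hκi' : (κ : ℕ) < i := hκi
  have hi₀κ : (i₀ : ℕ) ≤ κ := by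
    rcases hκ.1 with ⟨k, hk, e⟩ | ⟨k, -, e⟩
    · rwa [s.p_injective e]
    · exact absurd e (s.p_ne_q κ k)
  have hi₀ : i₀ ≤ i := (hi₀κ.trans_lt hκi').le
  have posY : (V.D i₀ j).pos.radius = (V.D i₀ j).cost := (max_eq_left vY).symm
  rw [show V.M i₀ j = (V.D i₀ j).cost from posY] at kY
  obtain ⟨⟨c₁S, c₁T, -⟩, -⟩ := V.isBOS i₁ j
  obtain ⟨⟨c₂S, c₂T, d₂⟩, -⟩ := V.isBOS i₂ j
  obtain ⟨⟨c₃S, c₃T, d₃⟩, -⟩ := V.isBOS i j₃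
  set f := max (V.M i₂ j) (V.M i j₃) with hf
  have f₂ : V.M i₂ j ≤ f := le_max_left _ _
  have f₃ : V.M i j₃ ≤ f := le_max_right _ _
  have hfX : f < (V.D i j).cost := max_lt (K₂ _ kX) (K₃ _ kX)
  have hfY : f < (V.D i₀ j).cost := max_lt (K₂ _ kY) (K₃ _ kY)
  have hf0 : 0 ≤ f := ((V.D i₂ j).pos.radius_nonneg : 0 ≤ V.M i₂ j).trans f₂
  have rX := hf0.trans_lt hfX
  have rY := hf0.trans_lt hfY
  replace c₂S : ∀ x ∈ s.posSide i₂ j, dist x (V.D i₂ j).pos.center ≤ f :=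
    fun x hx => (c₂S x hx).trans f₂
  -- Validity bounds the negative radius by the positive one, so `f` serves for both disks.
  replace c₂T : ∀ x ∈ s.negSide i₂ j, dist x (V.D i₂ j).neg.center ≤ f :=
    fun x hx => ((c₂T x hx).trans v₂).trans f₂
  replace c₃S : ∀ x ∈ s.posSide i j₃, dist x (V.D i j₃).pos.center ≤ f :=
    fun x hx => (c₃S x hx).trans f₃
  replace c₃T : ∀ x ∈ s.negSide i j₃, dist x (V.D i j₃).neg.center ≤ f :=
    fun x hx => ((c₃T x hx).trans v₃).trans f₃
  have SX₂ := s.posSide_mono hi₂ (le_refl j)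
  have SX₃ := s.posSide_mono (le_refl i) hj₃
  have SYX := s.posSide_mono hi₀ (le_refl j)
  have TXY := s.negSide_anti hi₀ (le_refl j)
  have m₂X : (V.D i₂ j).neg.center ∈ reach δ (s.posSide i j) f :=
    ⟨_, d₂, fun x hx => c₂S x (SX₂ hx)⟩
  have m₃X : (V.D i j₃).neg.center ∈ reach δ (s.posSide i j) f :=
    ⟨_, d₃, fun x hx => c₃S x (SX₃ hx)⟩
  have reachY : ∀ {p z}, dist p z ≤ δ → (∀ x ∈ s.posSide i j, dist x p ≤ f) →
      z ∈ reach δ (s.posSide i₀ j) f := fun hpz h => ⟨_, hpz, fun x hx => h x (SYX hx)⟩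
  have m₂Y : (V.D i₂ j).neg.center ∈ reach δ (s.posSide i₀ j) f :=
    reachY d₂ fun x hx => c₂S x (SX₂ hx)
  -- the boundary points of the negative disk of the `(i, j)`-partition
  obtain ⟨x, hxT, hxc, hxi⟩ := hX.exists_inner_nonpos (s.negSide_finite i j) rX hfX m₂X
  obtain ⟨y, hyT, hyc, hyi⟩ := hX.exists_inner_nonpos (s.negSide_finite i j) rX hfX m₃X
  -- A point still covered by the negative disk of [i₂, j] is within `f` of its centre and cannot
  -- block it; so the blocking point has changed sides and is p-type.
  obtain ⟨kx, hkx, hkx', rfl⟩ := s.exists_p_of_mem_negSide_of_notMem (i' := i₂) hxT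
    fun h => not_le.2 (inner_pos_of_dist_lt hxc (c₂T _ h) hfX) hxi
  obtain ⟨ky, hky, hky', rfl⟩ := s.exists_q_of_mem_negSide_of_notMem (j' := j₃) hyT
    fun h => not_le.2 (inner_pos_of_dist_lt hyc (c₃T _ h) hfX) hyi
  have negX : (V.D i j).neg.radius = (V.D i j).cost :=
    le_antisymm (le_max_right _ _) (hxc ▸ hX.1.2.1 _ hxT)
  -- The entry above has a larger negative side, covered by a disk of radius less than the cost at
  -- [i, j].
  have notMED : ¬ (V.D i j).neg.IsMED (s.negSide i j) := fun h => by
    have := h.2 (V.D i₁ j).neg fun z hz => c₁T z (s.negSide_anti hi₁ (le_refl j) hz)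
    rw [negX] at this
    exact absurd ((this.trans v₁).trans_lt (K₁ _ kX)) (lt_irrefl _)
  have bdX : ∀ z ∈ s.negSide i j, dist z (V.D i j).neg.center = (V.D i j).cost →
      z = s.p kx ∨ z = s.q ky := by
    intro z hz hzc
    by_contra! hne
    have hsub : ({s.p kx, s.q ky, z} : Set ℂ) ⊆ (V.D i j).neg.boundaryPoints (s.negSide i j) := by
      rintro w (rfl | rfl | rfl)
      exacts [⟨hxT, hxc.trans negX.symm⟩, ⟨hyT, hyc.trans negX.symm⟩, ⟨hz, hzc.trans negX.symm⟩]
    have h₃ : ({s.p kx, s.q ky, z} : Set ℂ).encard = 3 :=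
      Set.encard_eq_three.2 ⟨_, _, _, s.p_ne_q kx ky, hne.1.symm, hne.2.symm, rfl⟩
    have := (Set.encard_le_encard hsub).trans ((hV i j).2 notMED)
    rw [h₃] at this
    exact absurd this (by norm_num)
  -- the boundary points of the negative disk of the `(i₀, j)`-partition
  have negY : (V.D i₀ j).neg.radius = (V.D i₀ j).cost := by
    obtain ⟨w, hwT, hwc, -⟩ := hY.exists_inner_nonpos (s.negSide_finite i₀ j) rY hfY m₂Y
    exact le_antisymm (le_max_right _ _) (hwc ▸ hY.1.2.1 _ hwT)
  obtain ⟨hkc, g, hgT, hgc, hblock⟩ := hY.exists_blocking_pair (s.negSide_finite i₀ j) rY posY negY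
    hκ hfY m₂Y fun Q hQ hQc h4 => hP Q
      (Finset.coe_subset.1 (hQ.trans (s.negSide_subset i₀ j))) h4 ⟨_, _, hQc⟩
  have κX : s.p κ ∈ s.posSide i j := Or.inl ⟨κ, hκi', rfl⟩
  -- Since `0 ≤ δ`, a positive centre `p` is itself reachable; if it were close to both `s.p κ` and
  -- `g`, neither would block it. Hence `g` is on the negative side of both solutions.
  have notBoth : ∀ p, (∀ x ∈ s.posSide i j, dist x p ≤ f) → ¬ dist g p ≤ f := fun p hp hgp =>
    not_le.2 (inner_pos_of_dist_lt hgc hgp hfY) (hblock f hfY p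
      (reachY (by simpa using hδ) hp) (inner_pos_of_dist_lt hkc (hp _ κX) hfY))
  have gT₂ := (s.mem_posSide_or_mem_negSide i₂ j hgT).resolve_left fun h =>
    notBoth _ (fun x hx => c₂S x (SX₂ hx)) (c₂S g h)
  have gT₃ := (s.mem_posSide_or_mem_negSide i j₃ hgT).resolve_left fun h =>
    notBoth _ (fun x hx => c₃S x (SX₃ hx)) (c₃S g h)
  refine false_of_blocking_pairs hfX hfY hxc hyc ((hY.1.2.1 _ (TXY hxT)).trans negY.le)
    ((hY.1.2.1 _ (TXY hyT)).trans negY.le) ?_ hkc hgc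
    (fun ρ hρ => hY.center_notMem_reach rY posY negY hρ) hblock d₂ d₃
    (fun z hz => c₂S z (SX₂ hz)) (fun z hz => c₃S z (SX₃ hz))
    (fun z hz => c₂S z (SX₂ (SYX hz))) (fun z hz => c₃S z (SX₃ (SYX hz)))
    (c₂S _ (SX₂ κX)) (c₃S _ (SX₃ κX)) (c₂T g gT₂) (c₃T g gT₃)
    (c₂S _ (Or.inl ⟨kx, hkx', rfl⟩)) (c₂T _ (Or.inr ⟨ky, hky, rfl⟩))
    (c₃S _ (Or.inr ⟨ky, hky', rfl⟩)) (c₃T _ (Or.inl ⟨kx, hkx, rfl⟩))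
  intro z hz hzx
  obtain ⟨w, hw, hwc, hwi⟩ := hX.exists_inner_nonpos (s.negSide_finite i j) rX hfX hz
  rcases bdX w hw hwc with rfl | rfl
  · exact absurd hzx (not_lt.2 hwi)
  · exact hwi
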